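/- **Theorem 1.** Let $d\ge 1$, let $\mathcal H=\mathbb C^d$, and let $q\in\mathbb N$. For a permutation $\pi\in S_N$ let $P_\pi$ be the operator on $\mathcal H^{\otimes N}$ given by $(P_\pi x)_{(i_1,\dots,i_N)}=x_{(i_{\pi(1)},\dots,i_{\pi(N)})}$, and for an operator $X$ on $\mathcal H^{\otimes N}$ put $$\mathsf P_N(X)=\frac1{N!}\sum_{\pi\in S_N}P_\pi^\dagger X P_\pi .$$ Let $A$ be an operator on $\mathcal H^{\otimes q}$ such that $\mathsf P_q(A)$ is Hermitian. Then the operators $X_n:=\mathsf P_{q+n}(A\otimes \mathbb 1^{\otimes n})$ are Hermitian; let $\mu_n(A)=\lambda_{\max}(X_n)$ be their largest eigenvalues. The number $\operatorname{Tr}[A\rho^{\otimes q}]$ is real for every density matrix $\rho$ on $\mathcal H$ (positive semidefinite with unit trace), its maximum over all density matrices is attained, the sequence $(\mu_n(A))_{n\ge0}$ is non-increasing, and $$\lim_{n\to\infty}\mu_n(A)=\max_\rho \operatorname{Tr}[A\rho^{\otimes q}].$$ Moreover, for every $n$ let $\psi_n$ be a unit eigenvector of $X_n$ for the eigenvalue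 $\mu_n(A)$, and let $\operatorname{Tr}_{q+n-1}$ denote the partial trace over all but one of the $q+n$ copies of $\mathcal H$ (whichever copy is kept for each $n$). 1. If the maximum is attained at a unique density matrix $\rho_{\rm opt}$, then $$\rho_{\rm opt}=\lim_{n\to\infty}\operatorname{Tr}_{q+n-1}\mathsf P_{q+n}(|\psi_n\rangle\langle\psi_n|);$$ and if in addition the eigenvalue $\mu_n(A)$ of $X_n$ is simple for all sufficiently large $n$ (so that $\psi_n$ is determined up to a phase), then $$\rho_{\rm opt}=\lim_{n\to\infty}\operatorname{Tr}_{q+n-1}|\psi_n\rangle\langle\psi_n| .$$ 2. In general, every limit point of the sequence $\operatorname{Tr}_{q+n-1}\mathsf P_{q+n}(|\psi_n\rangle\langle\psi_n|)$ lies in the convex hull of the set of density matrices at which the maximum is attained. -/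

import Mathlib

open Filter Topology Matrix
open scoped ComplexOrder

noncomputable section

/-- Operators on the `n`-fold tensor power of `ℂ^d`, as matrices over composite indices
`(i₁, …, iₙ)` with entries in `Fin d`. -/
abbrev Op (d n : ℕ) : Type := Matrix (Fin n → Fin d) (Fin n → Fin d) ℂ

/-- The permutation matrix `P_π`, i.e. `(P_π x)_{(i)} = x_{(i_{π(1)}, …, i_{π(n)})}`. -/
def permMatrix (d : ℕ) {n : ℕ} (π : Equiv.Perm (Fin n)) : Op d n :=
  Matrix.of fun i j => if i ∘ π = j then 1 else 0

/-- The symmetric part `(1/n!) ∑_π P_π† A P_π`. -/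
def symPart {d n : ℕ} (A : Op d n) : Op d n :=
  ((n.factorial : ℂ)⁻¹) • ∑ π : Equiv.Perm (Fin n), (permMatrix d π)ᴴ * A * permMatrix d π

/-- `A ⊗ 1^{⊗ n}`: `A` acts on the first `q` factors, the identity on the last `n`. -/
def tensorOne {d q : ℕ} (A : Op d q) (n : ℕ) : Op d (q + n) :=
  Matrix.of fun i j =>
    A (fun k => i (Fin.castAdd n k)) (fun k => j (Fin.castAdd n k)) *
      (1 : Op d n) (fun k => i (Fin.natAdd q k)) (fun k => j (Fin.natAdd q k))

/-- The tensor power `ρ^{⊗ q}`. -/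
def tensorPow {d : ℕ} (ρ : Matrix (Fin d) (Fin d) ℂ) (q : ℕ) : Op d q :=
  Matrix.of fun i j => ∏ k, ρ (i k) (j k)

/-- Density matrices: positive semidefinite with unit trace. -/
def densityMatrices (d : ℕ) : Set (Matrix (Fin d) (Fin d) ℂ) :=
  {ρ | ρ.PosSemidef ∧ ρ.trace = 1}

/-- `Tr[A ρ^{⊗ q}]`. -/
def traceValue {d q : ℕ} (A : Op d q) (ρ : Matrix (Fin d) (Fin d) ℂ) : ℂ :=
  (A * tensorPow ρ q).trace

/-- The density matrices that maximise (the real part of) `Tr[A ρ^{⊗ q}]`. -/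
def optimalStates {d q : ℕ} (A : Op d q) : Set (Matrix (Fin d) (Fin d) ℂ) :=
  {ρ | ρ ∈ densityMatrices d ∧
    ∀ σ ∈ densityMatrices d, (traceValue A σ).re ≤ (traceValue A ρ).re}

/-- The set of real eigenvalues of a complex matrix (all its eigenvalues if it is Hermitian). -/
def realEigenvalues {ι : Type*} [Fintype ι] [DecidableEq ι] (X : Matrix ι ι ℂ) : Set ℝ :=
  {x | Module.End.HasEigenvalue (Matrix.toLin' X) (x : ℂ)}

/-- The largest eigenvalue (of a Hermitian matrix). -/
def lambdaMax {ι : Type*} [Fintype ι] [DecidableEq ι] (X : Matrix ι ι ℂ) : ℝ :=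
  sSup (realEigenvalues X)

/-- `ψ` is a normalised eigenvector of `X` for its largest eigenvalue. -/
def IsTopEigenvector {ι : Type*} [Fintype ι] [DecidableEq ι] (X : Matrix ι ι ℂ) (ψ : ι → ℂ) :
    Prop :=
  star ψ ⬝ᵥ ψ = 1 ∧ X *ᵥ ψ = (lambdaMax X : ℂ) • ψ

/-- The largest eigenvalue of `X` is nondegenerate: its eigenspace is one-dimensional. -/
def HasSimpleTop {ι : Type*} [Fintype ι] [DecidableEq ι] (X : Matrix ι ι ℂ) : Prop :=
  Module.finrank ℂ (Module.End.eigenspace (Matrix.toLin' X) (lambdaMax X : ℂ)) = 1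

/-- The projector `|ψ⟩⟨ψ|` (for a unit vector `ψ`). -/
def ketbra {ι : Type*} (ψ : ι → ℂ) : Matrix ι ι ℂ :=
  Matrix.vecMulVec ψ (star ψ)

/-- The partial trace over all tensor factors except the `k`-th one. -/
def reduceTo {d N : ℕ} (k : Fin N) (M : Op d N) : Matrix (Fin d) (Fin d) ℂ :=
  Matrix.of fun a b => ∑ i : Fin N → Fin d, if i k = a then M i (Function.update i k b) else 0

/-- The symmetrised operator on `q + n` copies, `P_{q+n}(A ⊗ 1^{⊗ n})`. -/
def symExt {d q : ℕ} (A : Op d q) (n : ℕ) : Op d (q + n) :=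
  symPart (tensorOne A n)

/-- `μ_n(A)`. -/
def muSeq {d q : ℕ} (A : Op d q) (n : ℕ) : ℝ :=
  lambdaMax (symExt A n)

end

/-!
The inequality `Tr[A ρ^{⊗q}] ≤ μ_n(A)` holds because `ρ^{⊗(q+n)}` is a trial state for `X_n`, and
`μ_n(A)` is non-increasing because `X_{n+1}` is the symmetrisation of `X_n ⊗ 1`. Everything else
rests on a quantum de Finetti theorem, obtained from extreme points in the manner of Størmer.

A permutation-invariant state is determined by its moments, which are indexed by multisets of index
pairs `(i_k, j_k)`. The exchangeable states on infinitely many copies are thus a compact convex set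
`exchangeableStates d` of functions on multisets. An effect `0 ≤ E ≤ 1` measured on one copy splits
an exchangeable state into two exchangeable parts; if the state is extreme, both parts are multiples
of it, so that the moments factorise and the state is `ρ^{⊗N}` on `N` copies
(`contract_eq_smul_of_effect`, `marginal_eq_tensorPow`).

The symmetrised projectors onto the top eigenvectors `ψ_n` have, along any ultrafilter finer than
`atTop`, a limit `w` in `exchangeableStates d` (`exists_limit_topEigenvectors`), and the expectation
of `A` in `w` is `lim μ_n(A)`. A linear functional on a compact convex set is maximal at an extreme
point, so `lim μ_n(A)` is at most the maximum over product states. Hence `w` lies in the face where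
the expectation of `A` is maximal. The extreme points of that face are product states of optimal
density matrices, and by the Krein–Milman theorem the one-copy marginal of `w` is in the closure of
the convex hull of the latter, which is the hull itself since the optimal set is compact
(`oneBody_mem_convexHull`). This gives the assertion about limit points, and convergence when the
optimal state is unique. If the top eigenvalue is simple, `|ψ_n⟩⟨ψ_n|` is already permutation
invariant.
-/

/-! ### Hermitian and positive semidefinite matrices -/

section General

variable {ι : Type*} [Fintype ι] [DecidableEq ι]

theorem mem_realEigenvalues_iff {X : Matrix ι ι ℂ} {x : ℝ} :
    x ∈ realEigenvalues X ↔ (x : ℂ) ∈ spectrum ℂ X := by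
  rw [realEigenvalues, Set.mem_ofPred_eq, Module.End.hasEigenvalue_iff_mem_spectrum,
    Matrix.spectrum_toLin']

theorem realEigenvalues_eq_range {X : Matrix ι ι ℂ} (hX : X.IsHermitian) :
    realEigenvalues X = Set.range hX.eigenvalues := by
  ext x
  rw [mem_realEigenvalues_iff, hX.spectrum_eq_image_range]
  simp

theorem isGreatest_lambdaMax [Nonempty ι] {X : Matrix ι ι ℂ} (hX : X.IsHermitian) :
    IsGreatest (realEigenvalues X) (lambdaMax X) := by
  have hfin : (realEigenvalues X).Finite := by
    rw [realEigenvalues_eq_range hX]; exact Set.finite_range _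
  have hne : (realEigenvalues X).Nonempty := by
    rw [realEigenvalues_eq_range hX]; exact Set.range_nonempty _
  exact ⟨hne.csSup_mem hfin, fun x hx => le_csSup hfin.bddAbove hx⟩

/-- The largest eigenvalue characterised by the positive semidefinite order. -/
theorem posSemidef_smul_one_sub_iff [Nonempty ι] {X : Matrix ι ι ℂ} (hX : X.IsHermitian) {c : ℝ} :
    ((c : ℂ) • (1 : Matrix ι ι ℂ) - X).PosSemidef ↔ lambdaMax X ≤ c := by
  have hc : ((c : ℂ) • (1 : Matrix ι ι ℂ)).IsHermitian := by
    simp [Matrix.IsHermitian, Matrix.conjTranspose_smul]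
  rw [Matrix.posSemidef_iff_isHermitian_and_spectrum_nonneg]
  have halg : (c : ℂ) • (1 : Matrix ι ι ℂ) = algebraMap ℂ _ (c : ℂ) := by
    rw [Algebra.algebraMap_eq_smul_one]
  rw [halg, ← spectrum.singleton_sub_eq, ← halg]
  constructor
  · rintro ⟨-, h⟩
    have hmem := mem_realEigenvalues_iff.1 (isGreatest_lambdaMax hX).1
    have := h (Set.sub_mem_sub (Set.mem_singleton (c : ℂ)) hmem)
    have h' : (0 : ℂ) ≤ (c : ℂ) - (lambdaMax X : ℂ) := this
    rw [← Complex.ofReal_sub] at h'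
    have := Complex.zero_le_real.1 h'
    linarith
  · intro h
    refine ⟨hc.sub hX, ?_⟩
    rintro _ ⟨_, rfl, x, hx, rfl⟩
    rw [hX.spectrum_eq_image_range] at hx
    obtain ⟨y, hy, rfl⟩ := hx
    rw [← realEigenvalues_eq_range hX] at hy
    have := (isGreatest_lambdaMax hX).2 hy
    change (0 : ℂ) ≤ (c : ℂ) - (y : ℂ)
    rw [← Complex.ofReal_sub]
    exact Complex.zero_le_real.2 (by linarith)

open scoped MatrixOrder Matrix.Norms.L2Operator in
theorem Matrix.PosSemidef.exists_conjTranspose_mul_self {M : Matrix ι ι ℂ} (hM : M.PosSemidef) :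
    ∃ B : Matrix ι ι ℂ, M = Bᴴ * B :=
  CStarAlgebra.nonneg_iff_eq_star_mul_self.mp hM.nonneg

theorem Matrix.PosSemidef.trace_mul_nonneg {M N : Matrix ι ι ℂ} (hM : M.PosSemidef)
    (hN : N.PosSemidef) : 0 ≤ (M * N).trace := by
  obtain ⟨B, rfl⟩ := hN.exists_conjTranspose_mul_self
  rw [← Matrix.mul_assoc, Matrix.trace_mul_comm, ← Matrix.mul_assoc]
  exact (hM.mul_mul_conjTranspose_same B).trace_nonneg

omit [DecidableEq ι] in
theorem Matrix.IsHermitian.im_trace_mul {M N : Matrix ι ι ℂ} (hM : M.IsHermitian)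
    (hN : N.IsHermitian) : (M * N).trace.im = 0 := by
  have h : star (M * N).trace = (M * N).trace := by
    rw [← Matrix.trace_conjTranspose, Matrix.conjTranspose_mul, hM.eq, hN.eq,
      Matrix.trace_mul_comm]
  exact Complex.conj_eq_iff_im.1 h

/-- With `M = BᴴB`, an entry is an inner product of two columns of `B`, whose squared norms are
diagonal entries of `M`. -/
theorem Matrix.PosSemidef.norm_apply_le_trace {M : Matrix ι ι ℂ} (hM : M.PosSemidef) (i j : ι) :
    ‖M i j‖ ≤ M.trace.re := by
  obtain ⟨B, rfl⟩ := hM.exists_conjTranspose_mul_self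
  have htr : ((Bᴴ * B).trace).re = ∑ i, ∑ k, ‖B k i‖ ^ 2 := by
    simp only [Matrix.trace, Matrix.diag_apply, Matrix.mul_apply, Matrix.conjTranspose_apply,
      Complex.re_sum]
    refine Finset.sum_congr rfl fun i _ => Finset.sum_congr rfl fun k _ => ?_
    rw [← starRingEnd_apply, ← Complex.normSq_eq_conj_mul_self, Complex.ofReal_re,
      Complex.normSq_eq_norm_sq]
  have hcol : ∀ i, ∑ k, ‖B k i‖ ^ 2 ≤ ((Bᴴ * B).trace).re := fun i => by
    rw [htr]
    exact Finset.single_le_sum (f := fun i => ∑ k, ‖B k i‖ ^ 2)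
      (fun i _ => Finset.sum_nonneg fun k _ => by positivity) (Finset.mem_univ i)
  have h1 : ‖(Bᴴ * B) i j‖ ≤ ∑ k, (‖B k i‖ ^ 2 + ‖B k j‖ ^ 2) / 2 := by
    rw [Matrix.mul_apply]
    refine (norm_sum_le _ _).trans (Finset.sum_le_sum fun k _ => ?_)
    rw [norm_mul, Matrix.conjTranspose_apply, norm_star]
    nlinarith [sq_nonneg (‖B k i‖ - ‖B k j‖)]
  rw [← Finset.sum_div, Finset.sum_add_distrib] at h1
  linarith [hcol i, hcol j]

/-- Effects span all matrices: a Hermitian matrix is a difference of positive ones, and a positive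
matrix is a multiple of an effect. -/
theorem span_effects_eq_top :
    Submodule.span ℂ {E : Matrix ι ι ℂ | E.PosSemidef ∧ (1 - E).PosSemidef} = ⊤ := by
  cases isEmpty_or_nonempty ι
  · exact Subsingleton.elim _ _
  set S := Submodule.span ℂ {E : Matrix ι ι ℂ | E.PosSemidef ∧ (1 - E).PosSemidef}
  have hpos : ∀ E : Matrix ι ι ℂ, E.PosSemidef → E ∈ S := by
    intro E hE
    set r : ℝ := |lambdaMax E| + 1
    have hr : 0 < r := by positivity
    have hrE : ((r : ℂ) • (1 : Matrix ι ι ℂ) - E).PosSemidef :=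
      (posSemidef_smul_one_sub_iff hE.1).2 ((le_abs_self _).trans (by simp [r]))
    have hinv : (0 : ℂ) ≤ (r : ℂ)⁻¹ := by
      rw [← Complex.ofReal_inv]; exact Complex.zero_le_real.2 (by positivity)
    have hr0 : (r : ℂ) ≠ 0 := by exact_mod_cast hr.ne'
    have hmem : (r : ℂ)⁻¹ • E ∈ S := by
      refine Submodule.subset_span ⟨hE.smul hinv, ?_⟩
      have := hrE.smul hinv
      rwa [smul_sub, inv_smul_smul₀ hr0] at this
    have := S.smul_mem (r : ℂ) hmem
    rwa [smul_inv_smul₀ hr0] at this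
  have hherm : ∀ E : Matrix ι ι ℂ, E.IsHermitian → E ∈ S := by
    intro E hE
    set r : ℝ := |lambdaMax E|
    have hrE : ((r : ℂ) • (1 : Matrix ι ι ℂ) - E).PosSemidef :=
      (posSemidef_smul_one_sub_iff hE).2 (le_abs_self _)
    have := S.sub_mem (S.smul_mem (r : ℂ) (hpos 1 Matrix.PosSemidef.one)) (hpos _ hrE)
    rwa [sub_sub_cancel] at this
  refine (Submodule.eq_top_iff'.2 fun E => ?_)
  rw [← realPart_add_I_smul_imaginaryPart E]
  exact S.add_mem (hherm _ (realPart E).2) (S.smul_mem _ (hherm _ (imaginaryPart E).2))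

end General

/-! ### Symmetrisation and tensor products -/

section Sym

variable {d q : ℕ}

/-- Conjugation by `P_π⁻¹` is a reindexing of matrix entries. -/
theorem symPart_eq_sum_submatrix (A : Op d q) :
    symPart A = ((q.factorial : ℂ)⁻¹) •
      ∑ π : Equiv.Perm (Fin q), A.submatrix (fun i => i ∘ π) (fun i => i ∘ π) := by
  rw [symPart]
  congr 1
  refine Fintype.sum_equiv (Equiv.inv (Equiv.Perm (Fin q))) _ _ fun π => ?_
  have hcomp : ∀ a i : Fin q → Fin d, a ∘ π = i ↔ a = i ∘ ⇑π⁻¹ := fun a i => by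
    constructor
    · rintro rfl; ext k; simp
    · rintro rfl; ext k; simp
  ext i j
  simp only [Matrix.mul_apply, permMatrix, hcomp, Matrix.conjTranspose_apply, Matrix.of_apply,
    Matrix.submatrix_apply, Equiv.inv_apply, apply_ite star, star_one, star_zero, ite_mul, one_mul,
    zero_mul, mul_ite, mul_one, mul_zero, Finset.sum_ite_eq', Finset.mem_univ, if_true]

theorem symPart_smul (c : ℂ) (A : Op d q) : symPart (c • A) = c • symPart A := by
  simp only [symPart_eq_sum_submatrix, Matrix.submatrix_smul, Pi.smul_apply, ← Finset.smul_sum]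
  rw [smul_comm]

theorem symPart_sum {α : Type*} (s : Finset α) (F : α → Op d q) :
    symPart (∑ a ∈ s, F a) = ∑ a ∈ s, symPart (F a) := by
  simp only [symPart, Finset.mul_sum, Finset.sum_mul, Finset.smul_sum]
  exact Finset.sum_comm

theorem symPart_sub (A B : Op d q) : symPart (A - B) = symPart A - symPart B := by
  simp [symPart, Matrix.mul_sub, Matrix.sub_mul, smul_sub]

theorem inv_factorial_smul_sum_perm (A : Op d q) (n : ℕ) :
    ((n.factorial : ℂ)⁻¹) • ∑ _π : Equiv.Perm (Fin n), A = A := by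
  have : ((n.factorial : ℕ) : ℂ) ≠ 0 := by exact_mod_cast n.factorial_ne_zero
  rw [Finset.sum_const, Finset.card_univ, Fintype.card_perm, Fintype.card_fin,
    ← Nat.cast_smul_eq_nsmul ℂ, inv_smul_smul₀ this]

theorem symPart_of_invariant {A : Op d q}
    (h : ∀ π : Equiv.Perm (Fin q), A.submatrix (fun i => i ∘ π) (fun i => i ∘ π) = A) :
    symPart A = A := by
  simp only [symPart_eq_sum_submatrix, h, inv_factorial_smul_sum_perm]

theorem symPart_one : symPart (1 : Op d q) = 1 :=
  symPart_of_invariant fun π =>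
    Matrix.submatrix_one _ (π.surjective.injective_comp_right)

theorem symPart_submatrix (A : Op d q) (τ : Equiv.Perm (Fin q)) :
    symPart (A.submatrix (fun i => i ∘ τ) (fun i => i ∘ τ)) = symPart A := by
  simp only [symPart_eq_sum_submatrix]
  congr 1
  exact Fintype.sum_equiv (Equiv.mulRight τ) _ _ fun π => rfl

theorem submatrix_symPart (A : Op d q) (τ : Equiv.Perm (Fin q)) :
    (symPart A).submatrix (fun i => i ∘ τ) (fun i => i ∘ τ) = symPart A := by
  simp only [symPart_eq_sum_submatrix]
  ext i j
  simp only [Matrix.submatrix_apply, Matrix.smul_apply, Matrix.sum_apply]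
  congr 1
  exact Fintype.sum_equiv (Equiv.mulLeft τ) _ _ fun π => rfl

theorem trace_submatrix_perm (A : Op d q) (τ : Equiv.Perm (Fin q)) :
    (A.submatrix (fun i => i ∘ τ) (fun i => i ∘ τ)).trace = A.trace :=
  Fintype.sum_equiv (Equiv.arrowCongr τ.symm (Equiv.refl _)) _ _ fun _ => rfl

theorem mul_submatrix_perm (A B : Op d q) (τ : Equiv.Perm (Fin q)) :
    A.submatrix (fun i => i ∘ τ) (fun i => i ∘ τ) * B.submatrix (fun i => i ∘ τ) (fun i => i ∘ τ) =
      (A * B).submatrix (fun i => i ∘ τ) (fun i => i ∘ τ) :=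
  Matrix.submatrix_mul_equiv A B _ (Equiv.arrowCongr τ.symm (Equiv.refl (Fin d))) _

theorem trace_symPart_mul (A M : Op d q) :
    (symPart A * M).trace = (A * symPart M).trace := by
  simp only [symPart_eq_sum_submatrix, Matrix.smul_mul, Matrix.mul_smul, Finset.sum_mul,
    Finset.mul_sum, Matrix.trace_smul, Matrix.trace_sum]
  congr 1
  refine Fintype.sum_equiv (Equiv.inv (Equiv.Perm (Fin q))) _ _ fun π => ?_
  rw [← trace_submatrix_perm _ π⁻¹, ← mul_submatrix_perm, Matrix.submatrix_submatrix]
  have h : ((fun i : Fin q → Fin d => i ∘ ⇑π) ∘ fun i => i ∘ ⇑π⁻¹) = id := by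
    ext i k; simp
  rw [h, Matrix.submatrix_id_id]
  rfl

theorem Matrix.IsHermitian.symPart {A : Op d q} (hA : A.IsHermitian) :
    (symPart A).IsHermitian := by
  rw [symPart_eq_sum_submatrix, Matrix.IsHermitian, Matrix.conjTranspose_smul,
    Matrix.conjTranspose_sum]
  simp [hA.eq]

theorem Matrix.PosSemidef.symPart {A : Op d q} (hA : A.PosSemidef) :
    (symPart A).PosSemidef := by
  rw [symPart_eq_sum_submatrix]
  refine (Matrix.posSemidef_sum _ fun π _ => hA.submatrix _).smul ?_
  rw [← Complex.ofReal_natCast, ← Complex.ofReal_inv]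
  exact Complex.zero_le_real.2 (by positivity)

theorem trace_symPart (A : Op d q) : (symPart A).trace = A.trace := by
  have := trace_symPart_mul A 1
  rwa [symPart_one, Matrix.mul_one, Matrix.mul_one] at this

theorem tensorOne_eq_hadamard (A : Op d q) (n : ℕ) :
    tensorOne A n =
      Matrix.hadamard (A.submatrix (fun i k => i (Fin.castAdd n k)) fun i k => i (Fin.castAdd n k))
        ((1 : Op d n).submatrix (fun i k => i (Fin.natAdd q k)) fun i k => i (Fin.natAdd q k)) :=
  rfl

theorem Matrix.PosSemidef.tensorOne {A : Op d q} (hA : A.PosSemidef) (n : ℕ) :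
    (tensorOne A n).PosSemidef := by
  rw [tensorOne_eq_hadamard]
  exact (hA.submatrix _).hadamard (Matrix.PosSemidef.one.submatrix _)

theorem Matrix.IsHermitian.tensorOne {A : Op d q} (hA : A.IsHermitian) (n : ℕ) :
    (tensorOne A n).IsHermitian := by
  ext i j
  have h1 := congrFun₂ hA.eq (fun k => i (Fin.castAdd n k)) (fun k => j (Fin.castAdd n k))
  have h2 := congrFun₂ (Matrix.isHermitian_one (n := Fin n → Fin d) (α := ℂ)).eq
    (fun k => i (Fin.natAdd q k)) (fun k => j (Fin.natAdd q k))
  rw [Matrix.conjTranspose_apply] at h1 h2 ⊢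
  simp only [_root_.tensorOne, Matrix.of_apply, star_mul', h1, h2]

theorem ite_and_mul_one {p r : Prop} [Decidable p] [Decidable r] :
    (if p ∧ r then (1 : ℂ) else 0) = (if p then 1 else 0) * if r then 1 else 0 := by
  split_ifs <;> simp_all

theorem tensorOne_one (n : ℕ) : tensorOne (1 : Op d q) n = 1 := by
  ext i j
  simp only [tensorOne, Matrix.of_apply, Matrix.one_apply, ← ite_and_mul_one]
  refine if_congr ⟨fun h => ?_, fun h => by simp [h]⟩ rfl rfl
  ext k
  refine Fin.addCases (fun k => ?_) (fun k => ?_) k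
  · rw [congrFun h.1 k]
  · rw [congrFun h.2 k]

theorem tensorOne_sub (A B : Op d q) (n : ℕ) :
    tensorOne (A - B) n = tensorOne A n - tensorOne B n := by
  ext i j; simp [tensorOne, sub_mul]

theorem tensorOne_smul (c : ℂ) (A : Op d q) (n : ℕ) :
    tensorOne (c • A) n = c • tensorOne A n := by
  ext i j; simp [tensorOne, mul_assoc]

theorem tensorOne_sum {α : Type*} (s : Finset α) (F : α → Op d q) (n : ℕ) :
    tensorOne (∑ a ∈ s, F a) n = ∑ a ∈ s, tensorOne (F a) n := by
  ext i j; simp [tensorOne, Finset.sum_mul, Matrix.sum_apply]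

theorem symPart_tensorOne_submatrix (A : Op d q) (τ : Equiv.Perm (Fin q)) (n : ℕ) :
    symPart (tensorOne (A.submatrix (fun i => i ∘ τ) (fun i => i ∘ τ)) n) =
      symPart (tensorOne A n) := by
  rw [← symPart_submatrix (tensorOne A n)
    (finSumFinEquiv.permCongr (Equiv.sumCongr τ (Equiv.refl (Fin n))))]
  congr 1
  ext i j
  have hl : ∀ x : Fin (q + n) → Fin d, (fun k => (x ∘ (finSumFinEquiv.permCongr
      (Equiv.sumCongr τ (Equiv.refl (Fin n))))) (Fin.castAdd n k)) =
        (fun k => x (Fin.castAdd n k)) ∘ τ := fun x => by ext k; simp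
  have hr : ∀ x : Fin (q + n) → Fin d, (fun k => (x ∘ (finSumFinEquiv.permCongr
      (Equiv.sumCongr τ (Equiv.refl (Fin n))))) (Fin.natAdd q k)) =
        (fun k => x (Fin.natAdd q k)) := fun x => by ext k; simp
  simp only [tensorOne, Matrix.of_apply, Matrix.submatrix_apply, hl]
  rw [hr i, hr j]

/-- Symmetrising `A` before tensoring with the identity makes no difference. -/
theorem symPart_tensorOne_symPart (A : Op d q) (n : ℕ) :
    symPart (tensorOne (symPart A) n) = symPart (tensorOne A n) := by
  rw [symPart_eq_sum_submatrix A, tensorOne_smul, tensorOne_sum, symPart_smul, symPart_sum]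
  simp only [symPart_tensorOne_submatrix, inv_factorial_smul_sum_perm]

theorem symExt_isHermitian {A : Op d q} (hA : (symPart A).IsHermitian) (n : ℕ) :
    (symExt A n).IsHermitian := by
  rw [symExt, ← symPart_tensorOne_symPart]
  exact (hA.tensorOne n).symPart

/-- With one more copy, the extension of `A` is the symmetrisation of `X_n ⊗ 1`. The types agree
because `q + (n + 1)` is `(q + n) + 1` by definition. -/
theorem symExt_succ (A : Op d q) (n : ℕ) :
    symExt A (n + 1) = symPart (tensorOne (symExt A n) 1) := by
  have h : tensorOne A (n + 1) = tensorOne (tensorOne A n) 1 := by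
    ext i j
    have hs : ∀ x y : Fin (n + 1) → Fin d, (1 : Op d (n + 1)) x y =
        (1 : Op d n) (fun k => x k.castSucc) (fun k => y k.castSucc) *
          (1 : Op d 1) (fun _ => x (Fin.last n)) (fun _ => y (Fin.last n)) := fun x y => by
      simp only [Matrix.one_apply, ← ite_and_mul_one]
      refine if_congr ⟨fun h => by simp [h], fun h => ?_⟩ rfl rfl
      ext k
      refine Fin.lastCases ?_ (fun k => ?_) k
      · rw [congrFun h.2 0]
      · rw [congrFun h.1 k]
    simp only [tensorOne, Matrix.of_apply]
    have hlast : ∀ x : Fin (q + (n + 1)) → Fin d, (fun k : Fin 1 => x (Fin.natAdd (q + n) k)) =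
        fun _ => x (Fin.natAdd q (Fin.last n)) := fun x => by
      ext k; rw [Subsingleton.elim k 0]; rfl
    rw [hs, ← mul_assoc, hlast i, hlast j]
    rfl
  rw [symExt, h, symExt, symPart_tensorOne_symPart]

/-- The tensor power is a Hadamard product of the matrices `(i, j) ↦ ρ (i k) (j k)`. -/
theorem tensorPow_posSemidef {ρ : Matrix (Fin d) (Fin d) ℂ} (hρ : ρ.PosSemidef) (q : ℕ) :
    (tensorPow ρ q).PosSemidef := by
  have h : ∀ s : Finset (Fin q), (Matrix.of fun i j : Fin q → Fin d =>
      ∏ k ∈ s, ρ (i k) (j k)).PosSemidef := by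
    intro s
    induction s using Finset.induction_on with
    | empty =>
      -- the matrix with all entries `1`
      simpa [Matrix.vecMulVec] using! Matrix.posSemidef_vecMulVec_self_star
        (fun _ : Fin q → Fin d => (1 : ℂ))
    | insert k s hk ih =>
      simpa only [Finset.prod_insert hk] using!
        (hρ.submatrix fun i : Fin q → Fin d => i k).hadamard ih
  exact h Finset.univ

theorem muSeq_antitone [NeZero d] {A : Op d q} (hA : (symPart A).IsHermitian) :
    Antitone (muSeq A) := by
  refine antitone_nat_of_succ_le fun n => ?_
  refine (posSemidef_smul_one_sub_iff (symExt_isHermitian hA (n + 1))).1 ?_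
  have h := (((posSemidef_smul_one_sub_iff (symExt_isHermitian hA n)).2 le_rfl).tensorOne
    1).symPart
  rw [tensorOne_sub, tensorOne_smul, tensorOne_one, symPart_sub, symPart_smul, symPart_one,
    ← symExt_succ] at h
  exact h

theorem tensorPow_submatrix (ρ : Matrix (Fin d) (Fin d) ℂ) (τ : Equiv.Perm (Fin q)) :
    (tensorPow ρ q).submatrix (fun i => i ∘ τ) (fun i => i ∘ τ) = tensorPow ρ q := by
  ext i j
  exact Equiv.prod_comp τ fun k => ρ (i k) (j k)

theorem im_traceValue {A : Op d q} (hA : (symPart A).IsHermitian)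
    {ρ : Matrix (Fin d) (Fin d) ℂ} (hρ : ρ ∈ densityMatrices d) : (traceValue A ρ).im = 0 := by
  rw [traceValue, ← symPart_of_invariant (tensorPow_submatrix ρ), ← trace_symPart_mul]
  exact hA.im_trace_mul (tensorPow_posSemidef hρ.1 q).1

end Sym

noncomputable section

/-! ### Exchangeable states on infinitely many copies -/

section Moments

variable {d : ℕ}

/-- The matrix of the `N`-copy marginal of a moment function `w`: its entry at `(i, j)` is the value
of `w` at the multiset of the pairs `(i₁, j₁), …, (i_N, j_N)`. Indexing by multisets builds the
permutation invariance into the encoding. -/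
def marginal (w : Multiset (Fin d × Fin d) → ℂ) (N : ℕ) : Op d N :=
  Matrix.of fun i j => w (List.ofFn fun k => (i k, j k))

/-- `w` is the moment function of an unnormalised exchangeable state on `n` copies: tracing out a
copy is consistent, and the marginals on at most `n` copies are positive semidefinite. Values of `w`
on multisets with more than `n` elements are unconstrained. -/
structure IsExchangeable (n : ℕ) (w : Multiset (Fin d × Fin d) → ℂ) : Prop where
  sum_cons : ∀ m, m.card < n → ∑ a, w ((a, a) ::ₘ m) = w m
  posSemidef : ∀ N ≤ n, (marginal w N).PosSemidef

/-- Exchangeable states on infinitely many copies of `ℂ^d`. -/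
def exchangeableStates (d : ℕ) : Set (Multiset (Fin d × Fin d) → ℂ) :=
  {w | w 0 = 1 ∧ ∀ n, IsExchangeable n w}

theorem marginal_cons (w : Multiset (Fin d × Fin d) → ℂ) {N : ℕ} (a b : Fin d)
    (i j : Fin N → Fin d) :
    marginal w (N + 1) (Fin.cons a i) (Fin.cons b j) =
      w ((a, b) ::ₘ (List.ofFn fun k => (i k, j k) : Multiset (Fin d × Fin d))) := by
  simp [marginal, List.ofFn_succ]

theorem sum_fin_cons {N : ℕ} {M : Type*} [AddCommMonoid M] (f : (Fin (N + 1) → Fin d) → M) :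
    ∑ i, f i = ∑ a, ∑ i : Fin N → Fin d, f (Fin.cons a i) := by
  rw [← Fintype.sum_prod_type']
  exact (Fintype.sum_equiv (Fin.consEquiv fun _ => Fin d) _ _ fun _ => rfl).symm

theorem exists_ofFn_eq (m : Multiset (Fin d × Fin d)) :
    ∃ i j : Fin m.card → Fin d, m = (List.ofFn fun k => (i k, j k) : List _) := by
  induction m using Quotient.inductionOn with
  | h l => exact ⟨fun k => (l.get k).1, fun k => (l.get k).2, by simp⟩

theorem IsExchangeable.mono {n n' : ℕ} (h : n' ≤ n) {w : Multiset (Fin d × Fin d) → ℂ}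
    (hw : IsExchangeable n w) : IsExchangeable n' w :=
  ⟨fun m hm => hw.1 m (hm.trans_le h), fun N hN => hw.2 N (hN.trans h)⟩

theorem IsExchangeable.trace_marginal {n : ℕ} {w : Multiset (Fin d × Fin d) → ℂ}
    (hw : IsExchangeable n w) : ∀ N ≤ n, (marginal w N).trace = w 0 := by
  intro N
  induction N with
  | zero =>
    intro _
    simp [Matrix.trace, marginal]
  | succ N ih =>
    intro hN
    rw [← ih (Nat.le_of_succ_le hN), Matrix.trace, Matrix.trace, sum_fin_cons, Finset.sum_comm]
    refine Finset.sum_congr rfl fun i _ => ?_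
    simp only [Matrix.diag_apply, marginal_cons]
    exact hw.sum_cons _ (by simpa using hN)

/-- This bound is what makes the set of exchangeable states compact. -/
theorem IsExchangeable.norm_le {n : ℕ} {w : Multiset (Fin d × Fin d) → ℂ}
    (hw : IsExchangeable n w) {m : Multiset (Fin d × Fin d)} (hm : m.card ≤ n) :
    ‖w m‖ ≤ (w 0).re := by
  obtain ⟨i, j, hij⟩ := exists_ofFn_eq m
  rw [← hw.trace_marginal _ hm]
  conv_lhs => rw [hij]
  exact (hw.posSemidef _ hm).norm_apply_le_trace i j

theorem eq_zero_of_isExchangeable {w : Multiset (Fin d × Fin d) → ℂ}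
    (hw : ∀ n, IsExchangeable n w) (h0 : w 0 = 0) : w = 0 := by
  ext m
  have := (hw m.card).norm_le le_rfl
  simpa [h0] using this

theorem IsExchangeable.smul {n : ℕ} {w : Multiset (Fin d × Fin d) → ℂ}
    (hw : IsExchangeable n w) {c : ℂ} (hc : 0 ≤ c) : IsExchangeable n (c • w) :=
  ⟨fun m hm => by simp [← Finset.mul_sum, hw.sum_cons m hm],
    fun N hN => by simpa only [marginal] using! (hw.posSemidef N hN).smul hc⟩

theorem IsExchangeable.add {n : ℕ} {w w' : Multiset (Fin d × Fin d) → ℂ}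
    (hw : IsExchangeable n w) (hw' : IsExchangeable n w') : IsExchangeable n (w + w') :=
  ⟨fun m hm => by simp [Finset.sum_add_distrib, hw.sum_cons m hm, hw'.sum_cons m hm],
    fun N hN => by simpa only [marginal] using! (hw.posSemidef N hN).add (hw'.posSemidef N hN)⟩

theorem convex_exchangeableStates (d : ℕ) : Convex ℝ (exchangeableStates d) := by
  intro w hw w' hw' a b ha hb hab
  have hsmul : ∀ (c : ℝ) (v : Multiset (Fin d × Fin d) → ℂ), c • v = (c : ℂ) • v := fun c v => by
    ext m; simp
  rw [hsmul, hsmul]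
  refine ⟨?_, fun n => ((hw.2 n).smul (Complex.zero_le_real.2 ha)).add
    ((hw'.2 n).smul (Complex.zero_le_real.2 hb))⟩
  simp only [Pi.add_apply, Pi.smul_apply, hw.1, hw'.1, smul_eq_mul, mul_one]
  exact_mod_cast hab

/-! ### Compactness -/

theorem tendsto_marginal {α : Type*} {l : Filter α} {f : α → Multiset (Fin d × Fin d) → ℂ}
    {w : Multiset (Fin d × Fin d) → ℂ} (h : Tendsto f l (𝓝 w)) (N : ℕ) :
    Tendsto (fun a => marginal (f a) N) l (𝓝 (marginal w N)) :=
  tendsto_pi_nhds.2 fun _ => tendsto_pi_nhds.2 fun _ => tendsto_pi_nhds.1 h _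

theorem isClosed_posSemidef (ι : Type*) [Fintype ι] :
    IsClosed {M : Matrix ι ι ℂ | M.PosSemidef} := by
  simp only [Matrix.posSemidef_iff_dotProduct_mulVec, Set.ofPred_and, Set.ofPred_forall]
  refine IsClosed.inter ?_ (isClosed_iInter fun x => ?_)
  · exact isClosed_eq continuous_id.matrix_conjTranspose continuous_id
  · exact isClosed_le continuous_const (by fun_prop)

/-- Along an ultrafilter, states that are exchangeable on more and more copies have a limit, which
is an exchangeable state on infinitely many copies. -/
theorem exists_tendsto_exchangeableStates {α : Type*} (U : Ultrafilter α)
    (f : α → Multiset (Fin d × Fin d) → ℂ) (h0 : ∀ᶠ a in U, f a 0 = 1)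
    (hf : ∀ n, ∀ᶠ a in U, IsExchangeable n (f a)) :
    ∃ w ∈ exchangeableStates d, Tendsto f U (𝓝 w) := by
  have hlim : ∀ m, ∃ z : ℂ, Tendsto (fun a => f a m) U (𝓝 z) := fun m => by
    have hball : ∀ᶠ a in U, f a m ∈ Metric.closedBall (0 : ℂ) 1 := by
      filter_upwards [h0, hf m.card] with a h0 ha
      simpa [h0] using ha.norm_le le_rfl
    obtain ⟨z, -, hz⟩ := (isCompact_closedBall (0 : ℂ) 1).ultrafilter_le_nhds
      (U.map fun a => f a m) (le_principal_iff.2 hball)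
    exact ⟨z, hz⟩
  choose w hw using hlim
  have hw' : Tendsto f U (𝓝 w) := tendsto_pi_nhds.2 hw
  refine ⟨w, ⟨?_, fun n => ⟨fun m hm => ?_, fun N hN => ?_⟩⟩, hw'⟩
  · exact tendsto_nhds_unique (hw 0) (tendsto_const_nhds.congr' (h0.mono fun a ha => ha.symm))
  · exact tendsto_nhds_unique (tendsto_finsetSum _ fun a _ => hw _)
      ((hw m).congr' ((hf n).mono fun a ha => (ha.sum_cons m hm).symm))
  · exact (isClosed_posSemidef _).mem_of_tendsto (tendsto_marginal hw' N)
      ((hf n).mono fun a ha => ha.posSemidef N hN)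

theorem isCompact_exchangeableStates (d : ℕ) : IsCompact (exchangeableStates d) := by
  rw [isCompact_iff_ultrafilter_le_nhds]
  intro U hU
  have hU' : ∀ᶠ w in U, w ∈ exchangeableStates d := by simpa using hU
  exact exists_tendsto_exchangeableStates U id (hU'.mono fun w hw => hw.1)
    fun n => hU'.mono fun w hw => hw.2 n

/-! ### Extreme exchangeable states are product states -/

/-- The moment function obtained by measuring the effect `E` on one copy. -/
def contract (E : Matrix (Fin d) (Fin d) ℂ) (w : Multiset (Fin d × Fin d) → ℂ) :
    Multiset (Fin d × Fin d) → ℂ :=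
  fun m => ∑ a, ∑ b, E b a * w ((a, b) ::ₘ m)

/-- Contraction with `E`, as a linear map in `E`. -/
def contractLinear (w : Multiset (Fin d × Fin d) → ℂ) :
    Matrix (Fin d) (Fin d) ℂ →ₗ[ℂ] (Multiset (Fin d × Fin d) → ℂ) where
  toFun E := contract E w
  map_add' E F := by
    ext m; simp [contract, add_mul, Finset.sum_add_distrib]
  map_smul' c E := by
    ext m; simp [contract, Finset.mul_sum, mul_assoc]

/-- Measuring a positive `E` on one copy leaves an exchangeable state on the other copies. -/
theorem IsExchangeable.contract {n : ℕ} {w : Multiset (Fin d × Fin d) → ℂ}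
    (hw : IsExchangeable (n + 1) w) {E : Matrix (Fin d) (Fin d) ℂ} (hE : E.PosSemidef) :
    IsExchangeable n (contract E w) := by
  constructor
  · intro m hm
    simp only [_root_.contract]
    rw [Finset.sum_comm]
    refine Finset.sum_congr rfl fun a _ => ?_
    rw [Finset.sum_comm]
    refine Finset.sum_congr rfl fun b _ => ?_
    rw [← Finset.mul_sum, ← hw.sum_cons ((a, b) ::ₘ m) (by simpa using hm)]
    simp only [Multiset.cons_swap (a, b)]
  · intro N hN
    obtain ⟨B, rfl⟩ := hE.exists_conjTranspose_mul_self
    -- each row of `B` contributes a rank one effect, which compresses the marginal on `N + 1` copies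
    let V : Fin d → Matrix (Fin (N + 1) → Fin d) (Fin N → Fin d) ℂ := fun c =>
      Matrix.of fun I j => if Fin.tail I = j then star (B c (I 0)) else 0
    have key : marginal (_root_.contract (Bᴴ * B) w) N =
        ∑ c, (V c)ᴴ * marginal w (N + 1) * V c := by
      ext i j
      simp only [Matrix.sum_apply, Matrix.mul_apply, sum_fin_cons, Finset.sum_mul]
      simp only [V, Matrix.conjTranspose_apply, Matrix.of_apply, Fin.tail_cons, Fin.cons_zero,
        apply_ite star, star_star, star_zero, ite_mul, zero_mul, mul_ite, mul_zero,
        Finset.sum_ite_eq', Finset.sum_ite_irrel, Finset.sum_const_zero, Finset.mem_univ, if_true,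
        marginal_cons]
      simp only [marginal, _root_.contract, Matrix.of_apply, Matrix.mul_apply,
        Matrix.conjTranspose_apply, Finset.sum_mul]
      rw [Finset.sum_comm]
      conv_lhs => enter [2, b]; rw [Finset.sum_comm]
      rw [Finset.sum_comm]
      refine Finset.sum_congr rfl fun c _ => Finset.sum_congr rfl fun b _ =>
        Finset.sum_congr rfl fun a _ => by ring
    rw [key]
    exact Matrix.posSemidef_sum _ fun c _ =>
      (hw.posSemidef (N + 1) (by omega)).conjTranspose_mul_mul_same (V c)

theorem contract_one {w : Multiset (Fin d × Fin d) → ℂ} (hw : ∀ n, IsExchangeable n w) :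
    contract 1 w = w := by
  ext m
  simp [contract, Matrix.one_apply, (hw (m.card + 1)).sum_cons m (Nat.lt_succ_self _)]

/-- An effect `0 ≤ E ≤ 1` splits a state into two exchangeable parts, so it acts on an extreme
state as a scalar. -/
theorem contract_eq_smul_of_effect {w : Multiset (Fin d × Fin d) → ℂ}
    (hw : w ∈ (exchangeableStates d).extremePoints ℝ) {E : Matrix (Fin d) (Fin d) ℂ}
    (hE : E.PosSemidef) (hE' : (1 - E).PosSemidef) :
    contract E w = contract E w 0 • w := by
  obtain ⟨⟨hw0, hwn⟩, hext⟩ := hw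
  have hadd : contract E w + contract (1 - E) w = w := by
    have := (contractLinear w).map_add E (1 - E)
    rw [add_sub_cancel] at this
    exact this.symm.trans (contract_one hwn)
  have hadd' : contract (1 - E) w = w - contract E w := eq_sub_of_add_eq' hadd
  have hpos : ∀ {F : Matrix (Fin d) (Fin d) ℂ}, F.PosSemidef → ∀ n, IsExchangeable n
    (contract F w) := fun hF n => (hwn (n + 1)).contract hF
  have hval : ∀ {v : Multiset (Fin d × Fin d) → ℂ}, (∀ n, IsExchangeable n v) →
      ∃ t : ℝ, 0 ≤ t ∧ v 0 = t := fun {v} hv => by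
    have h := ((hv 0).posSemidef 0 le_rfl).trace_nonneg
    rw [(hv 0).trace_marginal 0 le_rfl] at h
    obtain ⟨hre, him⟩ := Complex.nonneg_iff.1 h
    exact ⟨_, hre, Complex.ext rfl him.symm⟩
  obtain ⟨t, ht, hEt⟩ := hval (hpos hE)
  obtain ⟨s, hs, hEs⟩ := hval (hpos hE')
  have hst : t + s = 1 := by
    have := congrFun hadd 0
    rw [Pi.add_apply, hEt, hEs, hw0] at this
    exact_mod_cast this
  -- if `t` or `s` vanishes, so does the corresponding part, as its trace is zero
  rcases ht.eq_or_lt with rfl | ht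
  · rw [hEt, Complex.ofReal_zero, zero_smul]
    exact eq_zero_of_isExchangeable (hpos hE) (by simpa using hEt)
  rcases hs.eq_or_lt with rfl | hs
  · have h := eq_zero_of_isExchangeable (hpos hE') (by simpa using hEs)
    rw [h, add_zero] at hadd
    rw [hadd, hw0, one_smul]
  have hmem : ∀ {v : Multiset (Fin d × Fin d) → ℂ} {r : ℝ}, (∀ n, IsExchangeable n v) → 0 < r →
      v 0 = r → (r : ℂ)⁻¹ • v ∈ exchangeableStates d := fun {v r} hv hr hvr => by
    have hr0 : (r : ℂ) ≠ 0 := by exact_mod_cast hr.ne'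
    refine ⟨by simp [hvr, hr0], fun n => (hv n).smul ?_⟩
    rw [← Complex.ofReal_inv]
    exact Complex.zero_le_real.2 (by positivity)
  have ht0 : (t : ℂ) ≠ 0 := by exact_mod_cast ht.ne'
  have hs0 : (s : ℂ) ≠ 0 := by exact_mod_cast hs.ne'
  have hseg : w ∈ openSegment ℝ ((t : ℂ)⁻¹ • contract E w) ((s : ℂ)⁻¹ • contract (1 - E) w) := by
    refine ⟨t, s, ht, hs, hst, ?_⟩
    conv_rhs => rw [← hadd]
    ext m
    simp [ht0, hs0]
  have := hext (hmem (hpos hE) ht hEt) (hmem (hpos hE') hs hEs) hseg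
  rw [hEt]
  conv_rhs => rw [← this]
  rw [smul_inv_smul₀ ht0]

theorem contract_eq_smul {w : Multiset (Fin d × Fin d) → ℂ}
    (hw : w ∈ (exchangeableStates d).extremePoints ℝ) (E : Matrix (Fin d) (Fin d) ℂ) :
    contract E w = contract E w 0 • w := by
  have hE : E ∈ Submodule.span ℂ {E : Matrix (Fin d) (Fin d) ℂ |
      E.PosSemidef ∧ (1 - E).PosSemidef} := by
    rw [span_effects_eq_top]; trivial
  change contractLinear w E = contractLinear w E 0 • w
  induction hE using Submodule.span_induction with
  | mem E hE => exact contract_eq_smul_of_effect hw hE.1 hE.2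
  | zero => simp
  | add E F _ _ hE hF => rw [map_add, Pi.add_apply, add_smul, ← hE, ← hF]
  | smul c E _ hE => rw [map_smul, Pi.smul_apply, smul_assoc, ← hE]

/-- The one-copy marginal, as a matrix over `Fin d`. -/
def oneBody (w : Multiset (Fin d × Fin d) → ℂ) : Matrix (Fin d) (Fin d) ℂ :=
  Matrix.of fun a b => w {(a, b)}

theorem oneBody_mem_densityMatrices {w : Multiset (Fin d × Fin d) → ℂ}
    (hw : w ∈ exchangeableStates d) : oneBody w ∈ densityMatrices d := by
  constructor
  · have := ((hw.2 1).posSemidef 1 le_rfl).submatrix fun (a : Fin d) (_ : Fin 1) => a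
    simpa [marginal, oneBody] using! this
  · have := (hw.2 1).sum_cons 0 (by simp)
    rw [hw.1] at this
    exact this

/-- The de Finetti property: an extreme exchangeable state is the product state of its one-copy
marginal. -/
theorem marginal_eq_tensorPow {w : Multiset (Fin d × Fin d) → ℂ}
    (hw : w ∈ (exchangeableStates d).extremePoints ℝ) (N : ℕ) :
    marginal w N = tensorPow (oneBody w) N := by
  have hcons : ∀ (p : Fin d × Fin d) m, w (p ::ₘ m) = w {p} * w m := by
    rintro ⟨a, b⟩ m
    have hsingle : ∀ m, contract (Matrix.single b a 1) w m = w ((a, b) ::ₘ m) := fun m => by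
      simp [contract, Matrix.single_apply, ite_and]
    have := congrFun (contract_eq_smul hw (Matrix.single b a 1)) m
    rw [hsingle, Pi.smul_apply, hsingle] at this
    exact this
  have hprod : ∀ l : List (Fin d × Fin d), w l = (l.map fun p => w {p}).prod := by
    intro l
    induction l with
    | nil => exact hw.1.1
    | cons p l ih => rw [← Multiset.cons_coe, hcons, ih, List.map_cons, List.prod_cons]
  ext i j
  simp [marginal, tensorPow, oneBody, hprod, List.map_ofFn, List.prod_ofFn]

end Moments

/-! ### Moments of permutation-invariant operators on finitely many copies -/

section FiniteCopies

/-- Two families with the same multiset of values differ by a permutation, glued from bijections of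
their fibres. -/
theorem exists_perm_of_map_univ_eq {α : Type*} [DecidableEq α] {N : ℕ} {f g : Fin N → α}
    (h : Finset.univ.val.map f = Finset.univ.val.map g) : ∃ τ : Equiv.Perm (Fin N), f = g ∘ τ := by
  have hcard : ∀ a, Nonempty ({k // f k = a} ≃ {k // g k = a}) := fun a => by
    refine ⟨Fintype.equivOfCardEq ?_⟩
    have := congrArg (Multiset.count a) h
    rw [Multiset.count_map, Multiset.count_map] at this
    rw [Fintype.card_subtype, Fintype.card_subtype]
    simpa only [Finset.card_def, Finset.filter_val, eq_comm] using this
  let e := fun a => (hcard a).some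
  refine ⟨((Equiv.sigmaFiberEquiv f).symm.trans (Equiv.sigmaCongrRight e)).trans
    (Equiv.sigmaFiberEquiv g), ?_⟩
  exact funext fun k => (e (f k) ⟨k, rfl⟩).2.symm

variable {d N : ℕ}

/-- The matrix element that a tensor factor contributes: a factor labelled `some p` is restricted to
the entry `p`, a factor labelled `none` is traced out. -/
def slotWeight : Option (Fin d × Fin d) → Fin d → Fin d → ℂ
  | none, a, b => if a = b then 1 else 0
  | some p, a, b => if p = (a, b) then 1 else 0

/-- The matrix element of the operator `σ` read off at the factors labelled `some p`, the factors
labelled `none` being traced out. -/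
def slotValue (σ : Op d N) (G : Fin N → Option (Fin d × Fin d)) : ℂ :=
  ∑ I, ∑ J, σ I J * ∏ k, slotWeight (G k) (I k) (J k)

/-- The moment function of an operator on `N` copies. The elements of the multiset are assigned to
the first factors in an arbitrary order, which does not matter if `σ` is permutation invariant;
elements beyond the `N`-th are ignored. -/
def momentsOf (σ : Op d N) : Multiset (Fin d × Fin d) → ℂ :=
  fun m => slotValue σ fun k => m.toList[(k : ℕ)]?

/-- Invariance under conjugation by all `P_π`. -/
def IsPermInvariant (σ : Op d N) : Prop :=
  ∀ π : Equiv.Perm (Fin N), σ.submatrix (fun i => i ∘ π) (fun i => i ∘ π) = σ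

theorem isPermInvariant_symPart (A : Op d N) : IsPermInvariant (symPart A) :=
  submatrix_symPart A

theorem slotValue_comp_perm {σ : Op d N} (hσ : IsPermInvariant σ)
    (G : Fin N → Option (Fin d × Fin d)) (τ : Equiv.Perm (Fin N)) :
    slotValue σ (G ∘ τ) = slotValue σ G := by
  refine (Fintype.sum_equiv (Equiv.arrowCongr τ.symm (Equiv.refl (Fin d))) _ _ fun I =>
    Fintype.sum_equiv (Equiv.arrowCongr τ.symm (Equiv.refl (Fin d))) _ _ fun J => ?_).symm
  congr 1
  · exact (congrFun₂ (hσ τ) I J).symm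
  · exact (Equiv.prod_comp τ fun k => slotWeight (G k) (I k) (J k)).symm

theorem slotValue_congr {σ : Op d N} (hσ : IsPermInvariant σ)
    {G G' : Fin N → Option (Fin d × Fin d)}
    (h : Finset.univ.val.map G = Finset.univ.val.map G') : slotValue σ G = slotValue σ G' := by
  obtain ⟨τ, rfl⟩ := exists_perm_of_map_univ_eq h
  exact slotValue_comp_perm hσ G' τ

theorem map_univ_getElem? {α : Type*} (l : List α) (h : l.length ≤ N) :
    Finset.univ.val.map (fun k : Fin N => l[(k : ℕ)]?) =
      (l.map some ++ List.replicate (N - l.length) none : List (Option α)) := by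
  rw [Fin.univ_val_map]
  congr 1
  refine List.ext_getElem (by simp [h]) fun k hk _ => ?_
  by_cases hkl : k < l.length
  · simp [hkl]
  · simp [List.getElem_append, hkl]

theorem momentsOf_coe {σ : Op d N} (hσ : IsPermInvariant σ) {l : List (Fin d × Fin d)}
    (h : l.length ≤ N) : momentsOf σ l = slotValue σ fun k => l[(k : ℕ)]? := by
  have hperm : (l : Multiset (Fin d × Fin d)).toList.Perm l := Multiset.coe_eq_coe.1 (by simp)
  refine slotValue_congr hσ ?_
  rw [map_univ_getElem? _ h, map_univ_getElem? _ (hperm.length_eq.trans_le h),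
    Multiset.coe_eq_coe, hperm.length_eq]
  exact (hperm.map some).append_right _

/-- Relabelling a traced-out factor by `(a, a)` and summing over `a` traces it out again. -/
theorem sum_slotValue_update (σ : Op d N) {G : Fin N → Option (Fin d × Fin d)} {k : Fin N}
    (hk : G k = none) :
    ∑ a, slotValue σ (Function.update G k (some (a, a))) = slotValue σ G := by
  simp only [slotValue]
  rw [Finset.sum_comm]
  refine Finset.sum_congr rfl fun I _ => ?_
  rw [Finset.sum_comm]
  refine Finset.sum_congr rfl fun J _ => ?_
  rw [← Finset.mul_sum]
  congr 1
  simp only [← Finset.mul_prod_erase Finset.univ _ (Finset.mem_univ k), Function.update_self, hk]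
  have h : ∀ a, ∏ x ∈ Finset.univ.erase k,
      slotWeight (Function.update G k (some (a, a)) x) (I x) (J x) =
      ∏ x ∈ Finset.univ.erase k, slotWeight (G x) (I x) (J x) := fun a =>
    Finset.prod_congr rfl fun x hx => by rw [Function.update_of_ne (Finset.ne_of_mem_erase hx)]
  simp only [h, ← Finset.sum_mul]
  congr 1
  simp only [slotWeight, Prod.mk.injEq]
  by_cases hIJ : I k = J k
  · simp [hIJ]
  · rw [if_neg hIJ]
    exact Finset.sum_eq_zero fun a _ => if_neg fun h => hIJ (h.1.symm.trans h.2)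

theorem sum_momentsOf_cons {σ : Op d N} (hσ : IsPermInvariant σ) {m : Multiset (Fin d × Fin d)}
    (hm : m.card < N) : ∑ a, momentsOf σ ((a, a) ::ₘ m) = momentsOf σ m := by
  induction m using Quotient.inductionOn with
  | h l =>
    have hl : l.length < N := by simpa using hm
    rw [Multiset.quot_mk_to_coe, momentsOf_coe hσ hl.le,
      ← sum_slotValue_update σ (k := ⟨l.length, hl⟩) (by simp)]
    refine Finset.sum_congr rfl fun a _ => ?_
    have hperm : (a, a) ::ₘ (l : Multiset (Fin d × Fin d)) = (l ++ [(a, a)] : List _) := by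
      rw [Multiset.cons_coe, Multiset.coe_eq_coe]
      exact (List.perm_append_singleton _ _).symm
    rw [hperm, momentsOf_coe hσ (by simpa using hl)]
    congr 1
    ext1 k
    rcases eq_or_ne k ⟨l.length, hl⟩ with rfl | hk
    · simp
    · rw [Function.update_of_ne hk]
      have hk' : (k : ℕ) ≠ l.length := fun h => hk (Fin.ext h)
      rcases lt_or_gt_of_ne hk' with h | h
      · rw [List.getElem?_append_left h]
      · rw [List.getElem?_eq_none (by simpa using h), List.getElem?_eq_none h.le]

theorem momentsOf_zero (σ : Op d N) : momentsOf σ 0 = σ.trace := by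
  have : ∀ I J : Fin N → Fin d, (∀ k, I k = J k) ↔ I = J := fun I J => funext_iff.symm
  simp [momentsOf, slotValue, slotWeight, Finset.prod_boole, this, Matrix.trace]

theorem marginal_momentsOf_apply {σ : Op d N} (hσ : IsPermInvariant σ) {M : ℕ} (h : M ≤ N)
    (i j : Fin M → Fin d) :
    marginal (momentsOf σ) M i j = ∑ I, ∑ J,
      if I ∘ Fin.castLE h = i ∧ J ∘ Fin.castLE h = j ∧
        (fun k : {k : Fin N // M ≤ k} => I k) = (fun k : {k : Fin N // M ≤ k} => J k)
      then σ I J else 0 := by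
  rw [marginal, Matrix.of_apply, momentsOf_coe hσ (by simpa using h), slotValue]
  refine Finset.sum_congr rfl fun I _ => Finset.sum_congr rfl fun J _ => ?_
  have hw : ∀ k : Fin N, slotWeight (List.ofFn fun k => (i k, j k))[(k : ℕ)]? (I k) (J k) =
      if (∀ hk : (k : ℕ) < M, I k = i ⟨k, hk⟩ ∧ J k = j ⟨k, hk⟩) ∧ (M ≤ k → I k = J k)
        then 1 else 0 := fun k => by
    by_cases hk : (k : ℕ) < M
    · simp [hk, slotWeight, eq_comm]
    · simp [hk, slotWeight, not_lt.1 hk]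
  have hiff : (∀ k ∈ (Finset.univ : Finset (Fin N)),
      (∀ hk : (k : ℕ) < M, I k = i ⟨k, hk⟩ ∧ J k = j ⟨k, hk⟩) ∧ (M ≤ k → I k = J k)) ↔ I ∘ Fin.castLE h = i ∧ J ∘ Fin.castLE h = j ∧
        (fun k : {k : Fin N // M ≤ k} => I k) = (fun k : {k : Fin N // M ≤ k} => J k) := by
    refine ⟨fun H => ⟨?_, ?_, ?_⟩, fun H k _ => ⟨fun hk => ⟨?_, ?_⟩, fun hk => ?_⟩⟩
    · ext1 k; exact ((H (Fin.castLE h k) (Finset.mem_univ _)).1 k.2).1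
    · ext1 k; exact ((H (Fin.castLE h k) (Finset.mem_univ _)).1 k.2).2
    · ext1 k; exact (H k (Finset.mem_univ _)).2 k.2
    · rw [← H.1]; rfl
    · rw [← H.2.1]; rfl
    · exact congrFun H.2.2 ⟨k, hk⟩
  simp only [hw, Finset.prod_boole, mul_ite, mul_one, mul_zero, hiff]

theorem isExchangeable_momentsOf {σ : Op d N} (hσ : IsPermInvariant σ) (hpos : σ.PosSemidef) :
    IsExchangeable N (momentsOf σ) := by
  refine ⟨fun m hm => sum_momentsOf_cons hσ hm, fun M h => ?_⟩
  -- Kraus operators of the partial trace, indexed by the basis states of the traced-out factors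
  let V : ({k : Fin N // M ≤ k} → Fin d) → Matrix (Fin N → Fin d) (Fin M → Fin d) ℂ := fun c =>
    Matrix.of fun I i => if I ∘ Fin.castLE h = i ∧ (fun k : {k : Fin N // M ≤ k} => I k) = c
      then 1 else 0
  have key : marginal (momentsOf σ) M = ∑ c, (V c)ᴴ * σ * V c := by
    ext i j
    rw [marginal_momentsOf_apply hσ h]
    simp only [Matrix.sum_apply, Matrix.mul_apply, V, Matrix.conjTranspose_apply, Matrix.of_apply,
      apply_ite star, star_one, star_zero, Finset.sum_mul]
    rw [Finset.sum_comm, Finset.sum_comm (s := Finset.univ (α := {k : Fin N // M ≤ k} → Fin d))]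
    refine Finset.sum_congr rfl fun J _ => ?_
    rw [Finset.sum_comm]
    refine Finset.sum_congr rfl fun I _ => ?_
    rw [Finset.sum_eq_single (fun k : {k : Fin N // M ≤ k} => J k)]
    · by_cases h1 : I ∘ Fin.castLE h = i <;> by_cases h2 : J ∘ Fin.castLE h = j <;> simp [h1, h2]
    · intro c _ hc
      simp [hc.symm]
    · simp
  rw [key]
  exact Matrix.posSemidef_sum _ fun c _ => hpos.conjTranspose_mul_mul_same (V c)

/-- The expectation of `A ⊗ 1` only involves the marginal on `q` copies. -/
theorem trace_tensorOne_mul {q n : ℕ} (A : Op d q) {σ : Op d (q + n)} (hσ : IsPermInvariant σ) :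
    (tensorOne A n * σ).trace = (A * marginal (momentsOf σ) q).trace := by
  have hle : q ≤ q + n := Nat.le_add_right q n
  have hrest : ∀ I J : Fin (q + n) → Fin d,
      ((fun k : {k : Fin (q + n) // q ≤ k} => I k) = fun k : {k : Fin (q + n) // q ≤ k} => J k) ↔
        (fun k => I (Fin.natAdd q k)) = fun k => J (Fin.natAdd q k) := fun I J => by
    constructor
    · intro H; ext1 k; exact congrFun H ⟨Fin.natAdd q k, by simp⟩
    · intro H
      ext1 ⟨k, hk⟩
      have hk' : k = Fin.natAdd q ⟨k - q, by omega⟩ := Fin.ext (by simp; omega)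
      have := congrFun H ⟨k - q, by omega⟩
      rw [← hk'] at this
      exact this
  simp only [Matrix.trace, Matrix.diag_apply, Matrix.mul_apply, marginal_momentsOf_apply hσ hle,
    Finset.mul_sum, hrest]
  symm
  calc _ = ∑ x, ∑ y, ∑ J, ∑ I, _ := Finset.sum_congr rfl fun x _ =>
        Finset.sum_congr rfl fun y _ => Finset.sum_comm
    _ = ∑ x, ∑ J, ∑ y, ∑ I, _ := Finset.sum_congr rfl fun x _ => Finset.sum_comm
    _ = ∑ J, ∑ x, ∑ y, ∑ I, _ := Finset.sum_comm
    _ = ∑ J, ∑ x, ∑ I, ∑ y, _ := Finset.sum_congr rfl fun J _ =>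
        Finset.sum_congr rfl fun x _ => Finset.sum_comm
    _ = ∑ J, ∑ I, ∑ x, ∑ y, _ := Finset.sum_congr rfl fun J _ => Finset.sum_comm
    _ = _ := Finset.sum_congr rfl fun J _ => Finset.sum_congr rfl fun I _ => by
        rw [Finset.sum_eq_single (J ∘ Fin.castLE hle), Finset.sum_eq_single (I ∘ Fin.castLE hle)]
        · simp only [tensorOne, Matrix.of_apply, Matrix.one_apply, true_and, mul_ite, mul_one,
            mul_zero, ite_mul, zero_mul,
            eq_comm (a := fun k => J (Fin.natAdd q k)) (b := fun k => I (Fin.natAdd q k))]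
          rfl
        · intro y _ hy; simp [hy.symm]
        · simp
        · intro x _ hx; simp [hx.symm]
        · simp

/-- By permutation invariance, it does not matter which copy the partial trace keeps. -/
theorem reduceTo_eq_oneBody {σ : Op d N} (hσ : IsPermInvariant σ) (k : Fin N) :
    reduceTo k σ = oneBody (momentsOf σ) := by
  ext a b
  have hN : 0 < N := k.pos
  have h1 : momentsOf σ {(a, b)} =
      slotValue σ (Function.update (fun _ => none) k (some (a, b))) := by
    have hsingle : ({(a, b)} : Multiset (Fin d × Fin d)) = ([(a, b)] : List _) := rfl
    rw [hsingle, momentsOf_coe hσ (l := [(a, b)]) hN,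
      ← slotValue_comp_perm hσ (Function.update _ _ _) (Equiv.swap ⟨0, hN⟩ k)]
    congr 1
    ext1 x
    by_cases hx : x = ⟨0, hN⟩
    · subst hx; simp
    · have h1 : Equiv.swap ⟨0, hN⟩ k x ≠ k := fun h => hx (by
        rw [← Equiv.swap_apply_left ⟨0, hN⟩ k] at h
        exact (Equiv.swap _ _).injective h)
      have h2 : (x : ℕ) ≠ 0 := fun h => hx (Fin.ext h)
      simp [Function.update_of_ne h1, h2]
  rw [oneBody, Matrix.of_apply, h1, reduceTo, Matrix.of_apply, slotValue]
  refine Finset.sum_congr rfl fun I _ => ?_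
  have hw : ∀ J : Fin N → Fin d, ∏ x, slotWeight
      (Function.update (fun _ => none) k (some (a, b)) x) (I x) (J x) =
      if I k = a ∧ J = Function.update I k b then 1 else 0 := fun J => by
    have : ∀ x, slotWeight (Function.update (fun _ => none) k (some (a, b)) x) (I x) (J x) =
        if (x = k → I k = a) ∧ J x = Function.update I k b x then 1 else 0 := fun x => by
      by_cases hx : x = k
      · subst hx; simp [slotWeight, eq_comm]
      · simp [slotWeight, hx, eq_comm]
    have hiff : (∀ x ∈ Finset.univ, (x = k → I k = a) ∧ J x = Function.update I k b x) ↔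
        I k = a ∧ J = Function.update I k b :=
      ⟨fun H => ⟨(H k (Finset.mem_univ _)).1 rfl, funext fun x => (H x (Finset.mem_univ _)).2⟩,
        fun H x _ => ⟨fun _ => H.1, congrFun H.2 x⟩⟩
    simp only [this, Finset.prod_boole, hiff]
  simp only [hw, mul_ite, mul_one, mul_zero]
  by_cases hI : I k = a <;> simp [hI]

end FiniteCopies

/-! ### Convex hulls of compact sets -/

/-- By Carathéodory's theorem, the convex hull of a compact set in a finite-dimensional space is a
continuous image of a product of compact sets. -/
theorem IsCompact.convexHull_of_finiteDimensional {E : Type*} [AddCommGroup E] [Module ℝ E]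
    [TopologicalSpace E] [ContinuousAdd E] [ContinuousSMul ℝ E] [FiniteDimensional ℝ E]
    {s : Set E} (hs : IsCompact s) : IsCompact (convexHull ℝ s) := by
  rcases s.eq_empty_or_nonempty with rfl | ⟨x₀, hx₀⟩
  · simp
  let n := Module.finrank ℝ E + 1
  let f : (Fin n → ℝ) × (Fin n → E) → E := fun p => ∑ i, p.1 i • p.2 i
  have hf : Continuous f := by fun_prop
  have himage : convexHull ℝ s = f '' (stdSimplex ℝ (Fin n) ×ˢ Set.univ.pi fun _ => s) := by
    refine Set.Subset.antisymm (fun x hx => ?_) ?_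
    · obtain ⟨ι, _, z, w, hz, hind, hw, hw1, rfl⟩ := eq_pos_convex_span_of_mem_convexHull hx
      have hcard : Fintype.card ι ≤ Fintype.card (Fin n) := by
        rw [Fintype.card_fin]
        exact hind.card_le_finrank_succ.trans
          (Nat.succ_le_succ (Submodule.finrank_le (vectorSpan ℝ (Set.range z))))
      obtain ⟨e⟩ := Function.Embedding.nonempty_of_card_le hcard
      have hwe : ∀ i, Function.extend e w 0 (e i) = w i := e.injective.extend_apply w 0
      have hze : ∀ i, Function.extend e z (fun _ => x₀) (e i) = z i :=
        e.injective.extend_apply z _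
      have hout : ∀ k, k ∉ Set.range e → Function.extend e w 0 k = 0 := fun k hk =>
        Function.extend_apply' _ _ _ hk
      refine ⟨(Function.extend e w 0, Function.extend e z fun _ => x₀), ⟨⟨fun k => ?_, ?_⟩,
        fun k _ => ?_⟩, ?_⟩
      · by_cases hk : k ∈ Set.range e
        · obtain ⟨i, rfl⟩ := hk
          simpa only [hwe] using (hw i).le
        · exact (hout k hk).ge
      · rw [← hw1]
        exact (Fintype.sum_of_injective e e.injective _ _ hout fun i => (hwe i).symm).symm
      · by_cases hk : k ∈ Set.range e
        · obtain ⟨i, rfl⟩ := hk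
          simpa only [hze] using hz (Set.mem_range_self i)
        · simpa only [Function.extend_apply' _ _ _ hk] using hx₀
      · exact (Fintype.sum_of_injective e e.injective _ _ (fun k hk => by simp [hout k hk])
          fun i => by simp only [hwe, hze]).symm
    · rintro _ ⟨⟨w, z⟩, ⟨hw, hz⟩, rfl⟩
      exact (convex_convexHull ℝ s).sum_mem (fun i _ => hw.1 i) hw.2
        fun i _ => subset_convexHull ℝ s (hz i trivial)
  rw [himage]
  exact ((isCompact_stdSimplex ℝ (Fin n)).prod (isCompact_univ_pi fun _ => hs)).image hf

/-! ### Maximising the objective over states -/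

section Limit

variable {d q : ℕ}

theorem isCompact_densityMatrices (d : ℕ) : IsCompact (densityMatrices d) := by
  have hball : IsCompact (Set.univ.pi fun _ : Fin d => Set.univ.pi fun _ : Fin d =>
      Metric.closedBall (0 : ℂ) 1) :=
    isCompact_univ_pi fun _ => isCompact_univ_pi fun _ => isCompact_closedBall 0 1
  refine hball.of_isClosed_subset (t := densityMatrices d) ?_ ?_
  · exact (isClosed_posSemidef (Fin d)).inter
      (isClosed_eq continuous_id.matrix_trace continuous_const)
  · intro ρ hρ a _ b _
    have := hρ.1.norm_apply_le_trace a b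
    rw [hρ.2] at this
    simpa using this

theorem continuous_re_traceValue (A : Op d q) : Continuous fun ρ => (traceValue A ρ).re := by
  simp only [traceValue, Matrix.trace, Matrix.diag_apply, Matrix.mul_apply, tensorPow,
    Matrix.of_apply]
  fun_prop

theorem densityMatrices_nonempty [NeZero d] : (densityMatrices d).Nonempty := by
  refine ⟨Matrix.single 0 0 1, ?_, by simp⟩
  have := Matrix.PosSemidef.diagonal (d := Pi.single (0 : Fin d) (1 : ℂ))
    (Pi.single_nonneg.2 zero_le_one)
  rwa [Matrix.diagonal_single] at this

theorem exists_mem_optimalStates [NeZero d] (A : Op d q) : (optimalStates A).Nonempty := by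
  obtain ⟨ρ, hρ, hmax⟩ := (isCompact_densityMatrices d).exists_isMaxOn densityMatrices_nonempty
    (continuous_re_traceValue A).continuousOn
  exact ⟨ρ, hρ, fun σ hσ => hmax hσ⟩

theorem isCompact_optimalStates (A : Op d q) : IsCompact (optimalStates A) := by
  have : optimalStates A = densityMatrices d ∩
      ⋂ σ ∈ densityMatrices d, {ρ | (traceValue A σ).re ≤ (traceValue A ρ).re} := by
    ext ρ; simp [optimalStates]
  rw [this]
  exact (isCompact_densityMatrices d).inter_right (isClosed_biInter fun σ _ =>
    isClosed_le continuous_const (continuous_re_traceValue A))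

/-- The expectation of `A` in the state with moments `w`, as a continuous real-linear functional. -/
def objective (A : Op d q) : (Multiset (Fin d × Fin d) → ℂ) →L[ℝ] ℝ where
  toFun w := (A * marginal w q).trace.re
  map_add' w w' := by
    have : marginal (w + w') q = marginal w q + marginal w' q := rfl
    rw [this, Matrix.mul_add, Matrix.trace_add, Complex.add_re]
  map_smul' c w := by
    have : marginal (c • w) q = c • marginal w q := rfl
    rw [this, Matrix.mul_smul, Matrix.trace_smul, Complex.smul_re, RingHom.id_apply]
  cont := by
    simp only [Matrix.trace, Matrix.diag_apply, Matrix.mul_apply, marginal, Matrix.of_apply]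
    fun_prop

theorem objective_of_extreme (A : Op d q) {w : Multiset (Fin d × Fin d) → ℂ}
    (hw : w ∈ (exchangeableStates d).extremePoints ℝ) :
    objective A w = (traceValue A (oneBody w)).re := by
  change (A * marginal w q).trace.re = _
  rw [marginal_eq_tensorPow hw, traceValue]

/-- The exchangeable states at which the expectation of `A` is maximal. -/
def maximalFace (A : Op d q) : Set (Multiset (Fin d × Fin d) → ℂ) :=
  {w ∈ exchangeableStates d | ∀ w' ∈ exchangeableStates d, objective A w' ≤ objective A w}

theorem isExposed_maximalFace (A : Op d q) :
    IsExposed ℝ (exchangeableStates d) (maximalFace A) :=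
  fun _ => ⟨objective A, rfl⟩

/-- Mixtures are no better than product states. -/
theorem objective_le_of_mem_optimalStates (A : Op d q) {w : Multiset (Fin d × Fin d) → ℂ}
    (hw : w ∈ exchangeableStates d) {ρ : Matrix (Fin d) (Fin d) ℂ} (hρ : ρ ∈ optimalStates A) :
    objective A w ≤ (traceValue A ρ).re := by
  have hK := isCompact_exchangeableStates d
  obtain ⟨w', hw', hmax⟩ := hK.exists_isMaxOn ⟨w, hw⟩ (objective A).continuous.continuousOn
  obtain ⟨e, he⟩ := ((isExposed_maximalFace A).isCompact hK).extremePoints_nonempty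
    ⟨w', hw', fun y hy => hmax hy⟩
  have he' := (isExposed_maximalFace A).isExtreme.extremePoints_subset_extremePoints he
  refine (he.1.2 w hw).trans ?_
  rw [objective_of_extreme A he']
  exact hρ.2 _ (oneBody_mem_densityMatrices he'.1)

/-- By the Krein–Milman theorem, the one-copy marginal of a maximiser is a mixture of optimal
states. -/
theorem oneBody_mem_convexHull [NeZero d] (A : Op d q) {w : Multiset (Fin d × Fin d) → ℂ}
    (hw : w ∈ maximalFace A)
    (hval : ∀ ρ ∈ optimalStates A, (traceValue A ρ).re ≤ objective A w) :
    oneBody w ∈ convexHull ℝ (optimalStates A) := by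
  let L : (Multiset (Fin d × Fin d) → ℂ) →ₗ[ℝ] Matrix (Fin d) (Fin d) ℂ :=
    { toFun := oneBody, map_add' := fun _ _ => rfl, map_smul' := fun _ _ => rfl }
  have hL : Continuous L := continuous_matrix fun a b => continuous_apply ({(a, b)} : Multiset _)
  have hface := isExposed_maximalFace A
  have hK := isCompact_exchangeableStates d
  have hclosed : IsClosed (convexHull ℝ (optimalStates A)) :=
    (isCompact_optimalStates A).convexHull_of_finiteDimensional.isClosed
  have hsub : maximalFace A ⊆ L ⁻¹' convexHull ℝ (optimalStates A) := by
    rw [← closure_convexHull_extremePoints (hface.isCompact hK)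
      (hface.convex (convex_exchangeableStates d))]
    refine closure_minimal (convexHull_min (fun e he => ?_) ?_) (hclosed.preimage hL)
    · have he' := hface.isExtreme.extremePoints_subset_extremePoints he
      refine subset_convexHull ℝ _ ⟨oneBody_mem_densityMatrices he'.1, fun σ hσ => ?_⟩
      obtain ⟨ρ, hρ⟩ := exists_mem_optimalStates A
      calc (traceValue A σ).re ≤ (traceValue A ρ).re := hρ.2 σ hσ
        _ ≤ objective A w := hval ρ hρ
        _ ≤ objective A e := he.1.2 w hw.1
        _ = (traceValue A (oneBody e)).re := objective_of_extreme A he'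
    · exact (convex_convexHull ℝ _).linear_preimage L
  exact hsub hw

/-! ### Top eigenvectors -/

theorem exists_isTopEigenvector {ι : Type*} [Fintype ι] [DecidableEq ι] [Nonempty ι]
    {X : Matrix ι ι ℂ} (hX : X.IsHermitian) : ∃ ψ, IsTopEigenvector X ψ := by
  obtain ⟨φ, hφ⟩ := Module.End.HasEigenvalue.exists_hasEigenvector (isGreatest_lambdaMax hX).1
  have hφ' : X *ᵥ φ = (lambdaMax X : ℂ) • φ := by simpa using hφ.apply_eq_smul
  have hpos : 0 < star φ ⬝ᵥ φ := by
    simpa using Matrix.dotProduct_star_self_pos_iff.2 hφ.2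
  obtain ⟨hre, him⟩ := Complex.pos_iff.1 hpos
  set r : ℝ := (star φ ⬝ᵥ φ).re
  have hr : star φ ⬝ᵥ φ = (r : ℂ) := Complex.ext rfl him.symm
  refine ⟨((√r)⁻¹ : ℂ) • φ, ?_, ?_⟩
  · have hsq : ((√r : ℝ) : ℂ) * (√r : ℝ) = r := by
      rw [← Complex.ofReal_mul, Real.mul_self_sqrt hre.le]
    have hr0 : (r : ℂ) ≠ 0 := by exact_mod_cast hre.ne'
    rw [star_smul, smul_dotProduct, dotProduct_smul, hr, smul_eq_mul, smul_eq_mul, star_inv₀,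
      Complex.star_def, Complex.conj_ofReal, ← mul_assoc, ← mul_inv, hsq, inv_mul_cancel₀ hr0]
  · rw [Matrix.mulVec_smul, hφ', smul_comm]

theorem ketbra_posSemidef {ι : Type*} [Fintype ι] (ψ : ι → ℂ) : (ketbra ψ).PosSemidef :=
  Matrix.posSemidef_vecMulVec_self_star ψ

theorem trace_mul_ketbra {ι : Type*} [Fintype ι] (X : Matrix ι ι ℂ) (ψ : ι → ℂ) :
    (X * ketbra ψ).trace = star ψ ⬝ᵥ X *ᵥ ψ := by
  rw [ketbra, Matrix.mul_vecMulVec, Matrix.trace_vecMulVec, dotProduct_comm]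

/-- If the largest eigenvalue of a permutation-invariant operator is simple, permutations act on
its eigenvector by phases. -/
theorem symPart_ketbra_of_hasSimpleTop {N : ℕ} {X : Op d N} (hX : IsPermInvariant X)
    (hsimple : HasSimpleTop X) {ψ : (Fin N → Fin d) → ℂ} (hψ : IsTopEigenvector X ψ) :
    symPart (ketbra ψ) = ketbra ψ := by
  refine symPart_of_invariant fun π => ?_
  have hψmem : ψ ∈ Module.End.eigenspace (Matrix.toLin' X) (lambdaMax X : ℂ) := by
    simpa [Module.End.mem_eigenspace_iff] using hψ.2
  let e : (Fin N → Fin d) ≃ (Fin N → Fin d) := Equiv.arrowCongr π.symm (Equiv.refl (Fin d))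
  let φ : (Fin N → Fin d) → ℂ := fun i => ψ (i ∘ π)
  have hφ : X *ᵥ φ = (lambdaMax X : ℂ) • φ := by
    ext i
    have h1 := congrFun hψ.2 (i ∘ π)
    rw [Pi.smul_apply] at h1 ⊢
    rw [← h1]
    refine Fintype.sum_equiv e _ _ fun j => ?_
    have h2 := congrFun₂ (hX π) i j
    rw [Matrix.submatrix_apply] at h2
    change X i j * ψ (j ∘ π) = X (i ∘ π) (j ∘ π) * ψ (j ∘ π)
    rw [h2]
  have hφmem : φ ∈ Module.End.eigenspace (Matrix.toLin' X) (lambdaMax X : ℂ) := by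
    simpa [Module.End.mem_eigenspace_iff] using hφ
  have hψ0 : (⟨ψ, hψmem⟩ : Module.End.eigenspace (Matrix.toLin' X) (lambdaMax X : ℂ)) ≠ 0 := by
    intro h
    have h0 : ψ = 0 := congrArg Subtype.val h
    have := hψ.1
    simp [h0] at this
  obtain ⟨c, hc⟩ := (finrank_eq_one_iff_of_nonzero' _ hψ0).1 hsimple ⟨φ, hφmem⟩
  have hcφ : c • ψ = φ := congrArg Subtype.val hc
  have hnorm : star φ ⬝ᵥ φ = 1 := by
    rw [← hψ.1]
    exact Fintype.sum_equiv e _ _ fun i => rfl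
  have hc1 : c * star c = 1 := by
    rw [← hcφ, star_smul, smul_dotProduct, dotProduct_smul, hψ.1] at hnorm
    simpa [mul_comm] using hnorm
  have : (ketbra ψ).submatrix (fun i => i ∘ π) (fun i => i ∘ π) = ketbra φ := rfl
  rw [this, ← hcφ]
  ext i j
  simp only [ketbra, Matrix.vecMulVec_apply, Pi.smul_apply, Pi.star_apply, smul_eq_mul, star_mul']
  linear_combination ψ i * star (ψ j) * hc1

/-! ### The limit of the top eigenvectors -/

theorem slotValue_tensorPow {N : ℕ} (ρ : Matrix (Fin d) (Fin d) ℂ)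
    (G : Fin N → Option (Fin d × Fin d)) :
    slotValue (tensorPow ρ N) G = ∏ k, ∑ a, ∑ b, ρ a b * slotWeight (G k) a b := by
  simp only [slotValue, tensorPow, Matrix.of_apply, ← Finset.prod_mul_distrib,
    Finset.prod_univ_sum, Fintype.piFinset_univ]

theorem marginal_momentsOf_tensorPow {ρ : Matrix (Fin d) (Fin d) ℂ} (hρ : ρ.trace = 1) {M N : ℕ}
    (h : M ≤ N) : marginal (momentsOf (tensorPow ρ N)) M = tensorPow ρ M := by
  let f : Option (Fin d × Fin d) → ℂ := fun o => ∑ a, ∑ b, ρ a b * slotWeight o a b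
  have hnone : f none = 1 := by
    simpa [f, slotWeight, Matrix.trace] using hρ
  have hsome : ∀ p, f (some p) = ρ p.1 p.2 := fun p => by
    obtain ⟨a, b⟩ := p
    simp [f, slotWeight, ite_and]
  ext i j
  have hlist := congrArg (fun m => (m.map f).prod)
    (map_univ_getElem? (N := N) (List.ofFn fun k => (i k, j k)) (by simpa using h))
  rw [marginal, Matrix.of_apply, momentsOf_coe (tensorPow_submatrix ρ) (by simpa using h),
    slotValue_tensorPow]
  refine Eq.trans ?_ (hlist.trans ?_)
  · simp only [Multiset.map_map]
    rfl
  · simp [hnone, hsome, tensorPow, List.map_ofFn, List.prod_ofFn]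

/-- The product state `ρ^{⊗(q+n)}` is a trial state for the largest eigenvalue. -/
theorem traceValue_re_le_muSeq [NeZero d] {A : Op d q} (hA : (symPart A).IsHermitian)
    {ρ : Matrix (Fin d) (Fin d) ℂ} (hρ : ρ ∈ densityMatrices d) (n : ℕ) :
    (traceValue A ρ).re ≤ muSeq A n := by
  have hX := symExt_isHermitian hA n
  have htop := (posSemidef_smul_one_sub_iff hX).2 le_rfl
  have hpow := tensorPow_posSemidef hρ.1 (q + n)
  have htr : (tensorPow ρ (q + n)).trace = 1 := by
    rw [← momentsOf_zero]
    have := congrFun₂ (marginal_momentsOf_tensorPow hρ.2 (Nat.zero_le (q + n))) 0 0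
    simpa [marginal, tensorPow] using this
  have hval : (symExt A n * tensorPow ρ (q + n)).trace = traceValue A ρ := by
    rw [symExt, trace_symPart_mul, symPart_of_invariant (tensorPow_submatrix ρ),
      trace_tensorOne_mul A (tensorPow_submatrix ρ),
      marginal_momentsOf_tensorPow hρ.2 (Nat.le_add_right q n), traceValue]
  have h := (Complex.nonneg_iff.1 (htop.trace_mul_nonneg hpow)).1
  rw [Matrix.sub_mul, Matrix.trace_sub, hval, Matrix.smul_mul, Matrix.one_mul, Matrix.trace_smul,
    htr, smul_eq_mul, mul_one, Complex.sub_re, Complex.ofReal_re] at h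
  exact sub_nonneg.1 h

theorem isExchangeable_symPart_ketbra {n : ℕ} {ψ : (Fin n → Fin d) → ℂ}
    (hψ : star ψ ⬝ᵥ ψ = 1) : momentsOf (symPart (ketbra ψ)) 0 = 1 ∧
      IsExchangeable n (momentsOf (symPart (ketbra ψ))) := by
  refine ⟨?_, isExchangeable_momentsOf (isPermInvariant_symPart _) (ketbra_posSemidef ψ).symPart⟩
  have := trace_mul_ketbra 1 ψ
  rwa [Matrix.one_mul, Matrix.one_mulVec, hψ, ← trace_symPart, ← momentsOf_zero] at this

theorem objective_topEigenvector {A : Op d q} {n : ℕ} {ψ : (Fin (q + n) → Fin d) → ℂ}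
    (hψ : IsTopEigenvector (symExt A n) ψ) :
    objective A (momentsOf (symPart (ketbra ψ))) = muSeq A n := by
  change (A * marginal _ q).trace.re = _
  rw [← trace_tensorOne_mul A (isPermInvariant_symPart _), ← trace_symPart_mul, ← symExt,
    trace_mul_ketbra, hψ.2, dotProduct_smul, hψ.1, smul_eq_mul, mul_one, Complex.ofReal_re, muSeq]

/-- Along an ultrafilter, the symmetrised top eigenvectors converge to an exchangeable state on
infinitely many copies. -/
theorem exists_limit_topEigenvectors {A : Op d q} {ψ : (n : ℕ) → (Fin (q + n) → Fin d) → ℂ}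
    (hψ : ∀ n, IsTopEigenvector (symExt A n) (ψ n)) {U : Ultrafilter ℕ} (hU : (U : Filter ℕ) ≤ atTop)
    {v : ℝ} (hv : Tendsto (muSeq A) atTop (𝓝 v)) :
    ∃ w ∈ exchangeableStates d, objective A w = v ∧
      Tendsto (fun n => momentsOf (symPart (ketbra (ψ n)))) U (𝓝 w) := by
  obtain ⟨w, hw, hlim⟩ := exists_tendsto_exchangeableStates U
    (fun n => momentsOf (symPart (ketbra (ψ n))))
    (Eventually.of_forall fun n => (isExchangeable_symPart_ketbra (hψ n).1).1)
    fun n => hU ((eventually_ge_atTop n).mono fun k hk =>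
      (isExchangeable_symPart_ketbra (hψ k).1).2.mono (by omega))
  refine ⟨w, hw, ?_, hlim⟩
  have h1 := ((objective A).continuous.tendsto w).comp hlim
  exact tendsto_nhds_unique (h1.congr fun n => objective_topEigenvector (hψ n)) (hv.mono_left hU)

/-- The limit is at least the maximum by `traceValue_re_le_muSeq`, and at most the maximum because it
is the expectation of `A` in an exchangeable state. -/
theorem tendsto_muSeq [NeZero d] {A : Op d q} (hA : (symPart A).IsHermitian)
    {ρ : Matrix (Fin d) (Fin d) ℂ} (hρ : ρ ∈ optimalStates A) :
    Tendsto (muSeq A) atTop (𝓝 (traceValue A ρ).re) := by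
  have hlim := tendsto_atTop_ciInf (muSeq_antitone hA)
    ⟨(traceValue A ρ).re, by rintro _ ⟨n, rfl⟩; exact traceValue_re_le_muSeq hA hρ.1 n⟩
  choose ψ hψ using fun n => exists_isTopEigenvector (symExt_isHermitian hA n)
  obtain ⟨w, hw, hval, -⟩ := exists_limit_topEigenvectors hψ (Ultrafilter.of_le atTop) hlim
  have hle := objective_le_of_mem_optimalStates A hw hρ
  have hge := ge_of_tendsto' hlim (traceValue_re_le_muSeq hA hρ.1)
  rwa [← le_antisymm (hval ▸ hle) hge]

/-- Every limit along an ultrafilter of the one-copy marginals is a mixture of optimal states. -/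
theorem exists_tendsto_reduceTo [NeZero d] {A : Op d q} (hA : (symPart A).IsHermitian)
    {ψ : (n : ℕ) → (Fin (q + n) → Fin d) → ℂ} (hψ : ∀ n, IsTopEigenvector (symExt A n) (ψ n))
    (k : (n : ℕ) → Fin (q + n)) {U : Ultrafilter ℕ} (hU : (U : Filter ℕ) ≤ atTop) :
    ∃ τ ∈ convexHull ℝ (optimalStates A),
      Tendsto (fun n => reduceTo (k n) (symPart (ketbra (ψ n)))) U (𝓝 τ) := by
  obtain ⟨ρ, hρ⟩ := exists_mem_optimalStates A
  obtain ⟨w, hw, hval, hlim⟩ := exists_limit_topEigenvectors hψ hU (tendsto_muSeq hA hρ)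
  refine ⟨oneBody w, oneBody_mem_convexHull A
    ⟨hw, fun w' hw' => (objective_le_of_mem_optimalStates A hw' hρ).trans hval.ge⟩
    fun σ hσ => (hρ.2 σ hσ.1).trans hval.ge, ?_⟩
  simp only [fun n => reduceTo_eq_oneBody (isPermInvariant_symPart (ketbra (ψ n))) (k n)]
  exact tendsto_pi_nhds.2 fun a => tendsto_pi_nhds.2 fun b => tendsto_pi_nhds.1 hlim _

end Limit

end

theorem theorem1 (d q : ℕ) (hd : 0 < d) (A : Op d q) (hA : (symPart A).IsHermitian) :
    -- the matrices are Hermitian and `μ_n(A)` really is the largest eigenvalue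
    (∀ n, (symExt A n).IsHermitian ∧ IsGreatest (realEigenvalues (symExt A n)) (muSeq A n)) ∧
    -- the sequence is non-increasing
    Antitone (muSeq A) ∧
    -- the objective is real, its maximum is attained, and the sequence converges to it
    (∀ ρ ∈ densityMatrices d, (traceValue A ρ).im = 0) ∧
    (∃ v : ℝ, IsGreatest ((fun ρ => (traceValue A ρ).re) '' densityMatrices d) v ∧
      Tendsto (muSeq A) atTop (𝓝 v)) ∧
    -- the optimal state from the top eigenvectors; `k n` is the copy kept by the partial trace
    (∀ ψ : (n : ℕ) → (Fin (q + n) → Fin d) → ℂ,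
      (∀ n, IsTopEigenvector (symExt A n) (ψ n)) →
      ∀ k : (n : ℕ) → Fin (q + n),
        -- if there is only one optimal state, the reduced states converge to it
        (∀ ρopt, optimalStates A = {ρopt} →
          Tendsto (fun n => reduceTo (k n) (symPart (ketbra (ψ n)))) atTop (𝓝 ρopt) ∧
          ((∀ᶠ n in atTop, HasSimpleTop (symExt A n)) →
            Tendsto (fun n => reduceTo (k n) (ketbra (ψ n))) atTop (𝓝 ρopt))) ∧
        -- in general, their limit points are convex combinations of optimal states
        (∀ τ, MapClusterPt τ atTop (fun n => reduceTo (k n) (symPart (ketbra (ψ n)))) →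
          τ ∈ convexHull ℝ (optimalStates A))) := by
  have : NeZero d := ⟨hd.ne'⟩
  obtain ⟨ρ, hρ⟩ := exists_mem_optimalStates A
  refine ⟨fun n => ⟨symExt_isHermitian hA n, isGreatest_lambdaMax (symExt_isHermitian hA n)⟩,
    muSeq_antitone hA, fun ρ hρ => im_traceValue hA hρ,
    ⟨_, ⟨⟨ρ, hρ.1, rfl⟩, by rintro _ ⟨σ, hσ, rfl⟩; exact hρ.2 σ hσ⟩, tendsto_muSeq hA hρ⟩,
    fun ψ hψ k => ⟨fun ρopt hopt => ?_, fun τ hτ => ?_⟩⟩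
  · have hlim : Tendsto (fun n => reduceTo (k n) (symPart (ketbra (ψ n)))) atTop (𝓝 ρopt) := by
      rw [tendsto_iff_ultrafilter]
      intro U hU
      obtain ⟨τ, hτ, hlim⟩ := exists_tendsto_reduceTo hA hψ k hU
      rw [hopt, convexHull_singleton, Set.mem_singleton_iff] at hτ
      rwa [hτ] at hlim
    refine ⟨hlim, fun hsimple => hlim.congr' ?_⟩
    filter_upwards [hsimple] with n hn
    rw [symPart_ketbra_of_hasSimpleTop (isPermInvariant_symPart _) hn (hψ n)]
  · obtain ⟨U, hU, hτU⟩ := mapClusterPt_iff_ultrafilter.1 hτ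
    obtain ⟨τ', hτ', hlim⟩ := exists_tendsto_reduceTo hA hψ k hU
    rwa [tendsto_nhds_unique hτU hlim]
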